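/- Let $F$ be a field of characteristic zero, let $X=\{x_1,x_2,\dots\}$ be a countably infinite set of variables, and let $W_X(F)=\operatorname{Der}_F F[X]$ be the Lie algebra of all $F$-derivations $\sum_{i\ge 1} f_i\,\partial/\partial x_i$ ($f_i\in F[X]$) of the polynomial algebra $F[X]$, with the commutator bracket. For $n\ge 1$ let $W_n(F)=\operatorname{Der}F[x_1,\dots,x_n]$ be regarded as the subalgebra of $W_X(F)$ of all vector fields $\sum_{i=1}^n f_i\,\partial/\partial x_i$ with $f_i\in F[x_1,\dots,x_n]$, and let $W_\infty(F)=\bigcup_{n\ge1}W_n(F)$. Let $W_{\mathrm{fin}}(F)\subseteq W_X(F)$ be the subalgebra of all $\sum_{i\ge1} f_i\,\partial/\partial x_i$ such that each variable $x_n$ occurs in only finitely many of the polynomials $f_i$. Then for every ($F$-linear) derivation $d$ of the Lie algebra $W_\infty(F)$ there is an element $a\in W_{\mathrm{fin}}(F)$ such that $d(x)=[x,a]$ for all $x\in W_\infty(F)$. Moreover, not every derivation of $W_\infty(F)$ is inner: there is a derivation of $W_\infty(F)$ that is not of the form $x\mapsto[x,b]$ with $b\in W_\infty(F)$. -/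

import Mathlib

namespace PolyVect

open MvPolynomial

/-- The polynomial algebra `F[X]` on the countably many variables `x₁, x₂, …`;
the variable `x_{i+1}` is `X i`, for `i : ℕ`. -/
abbrev Poly (F : Type*) [Field F] : Type _ := MvPolynomial ℕ F

/-- The Lie algebra `W_X(F) = Der F[X]`, with the commutator bracket. The element
`∑ f_i ∂/∂x_i` is the derivation `D` with `D (X i) = f_i` (`MvPolynomial.mkDerivation`). -/
abbrev WX (F : Type*) [Field F] : Type _ := Derivation F (Poly F) (Poly F)

theorem apply_mem_supported {F : Type*} [Field F] (D : WX F) {s t : Set ℕ} (hst : s ⊆ t)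
    (hD : ∀ i ∈ s, D (X i) ∈ supported F t) {p : Poly F} (hp : p ∈ supported F s) :
    D p ∈ supported F t := by
  have hp' : p ∈ Algebra.adjoin F (X '' s) := hp
  induction hp' using Algebra.adjoin_induction with
  | mem x hx =>
    obtain ⟨i, hi, rfl⟩ := hx
    exact hD i hi
  | algebraMap r => simp
  | add x y hx hy ihx ihy =>
    rw [map_add]
    exact add_mem (ihx hx) (ihy hy)
  | mul x y hx hy ihx ihy =>
    rw [Derivation.leibniz, smul_eq_mul, smul_eq_mul]
    exact add_mem (mul_mem (supported_mono hst hx) (ihy hy))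
      (mul_mem (supported_mono hst hy) (ihx hx))

/-- The Lie algebra `W_n(F)`, as a subalgebra of `W_X(F)`: the vector fields
`∑_{i ≤ n} f_i ∂/∂x_i` whose coefficients are polynomials in `x₁, …, x_n`. -/
def Wn (F : Type*) [Field F] (n : ℕ) : LieSubalgebra F (WX F) where
  carrier := {D | (∀ i, i < n → D (X i) ∈ supported F (Set.Iio n)) ∧ ∀ i, n ≤ i → D (X i) = 0}
  zero_mem' := ⟨fun _ _ => by simp, fun _ _ => by simp⟩
  add_mem' := by
    rintro D E ⟨hD, hD'⟩ ⟨hE, hE'⟩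
    exact ⟨fun i hi => add_mem (hD i hi) (hE i hi), fun i hi => by simp [hD' i hi, hE' i hi]⟩
  smul_mem' := by
    rintro c D ⟨hD, hD'⟩
    exact ⟨fun i hi => Subalgebra.smul_mem _ (hD i hi) c, fun i hi => by simp [hD' i hi]⟩
  lie_mem' := by
    rintro D E ⟨hD, hD'⟩ ⟨hE, hE'⟩
    refine ⟨fun i hi => ?_, fun i hi => ?_⟩
    · rw [Derivation.commutator_apply]
      exact sub_mem (apply_mem_supported D subset_rfl hD (hE i hi))
        (apply_mem_supported E subset_rfl hE (hD i hi))
    · simp [Derivation.commutator_apply, hD' i hi, hE' i hi]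

theorem Wn_mono (F : Type*) [Field F] : Monotone (Wn F) := by
  rintro m n hmn D ⟨hD, hD'⟩
  refine ⟨fun i _ => ?_, fun i hi => hD' i (hmn.trans hi)⟩
  rcases lt_or_ge i m with h | h
  · exact supported_mono (Set.Iio_subset_Iio hmn) (hD i h)
  · rw [hD' i h]
    exact zero_mem _

/-- The Lie algebra `W_∞(F)`, the union of the ascending chain of the `W_n(F)`. -/
def Winf (F : Type*) [Field F] : LieSubalgebra F (WX F) where
  carrier := ⋃ n, (Wn F n : Set (WX F))
  zero_mem' := Set.mem_iUnion.2 ⟨0, zero_mem _⟩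
  add_mem' := by
    intro D E hD hE
    obtain ⟨m, hm⟩ := Set.mem_iUnion.1 hD
    obtain ⟨n, hn⟩ := Set.mem_iUnion.1 hE
    exact Set.mem_iUnion.2 ⟨max m n, add_mem (Wn_mono F (le_max_left m n) hm)
      (Wn_mono F (le_max_right m n) hn)⟩
  smul_mem' := by
    intro c D hD
    obtain ⟨m, hm⟩ := Set.mem_iUnion.1 hD
    exact Set.mem_iUnion.2 ⟨m, (Wn F m).smul_mem c hm⟩
  lie_mem' := by
    intro D E hD hE
    obtain ⟨m, hm⟩ := Set.mem_iUnion.1 hD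
    obtain ⟨n, hn⟩ := Set.mem_iUnion.1 hE
    exact Set.mem_iUnion.2 ⟨max m n, (Wn F (max m n)).lie_mem
      (Wn_mono F (le_max_left m n) hm) (Wn_mono F (le_max_right m n) hn)⟩

theorem finite_mem_vars_apply {F : Type*} [Field F] {D E : WX F}
    (hD : ∀ n, {i : ℕ | n ∈ (D (X i)).vars}.Finite)
    (hE : ∀ n, {i : ℕ | n ∈ (E (X i)).vars}.Finite) (n : ℕ) :
    {i : ℕ | n ∈ (D (E (X i))).vars}.Finite := by
  refine ((hE n).union ((hD n).biUnion fun j _ => hE j)).subset fun i hi => ?_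
  by_contra hcon
  simp only [Set.mem_union, Set.mem_iUnion, Set.mem_ofPred_eq, not_or, not_exists] at hcon hi
  have h : D (E (X i)) ∈ supported F ({n}ᶜ : Set ℕ) := by
    refine apply_mem_supported D (s := ↑(E (X i)).vars) ?_ ?_ (mem_supported.2 subset_rfl)
    · intro j hj hjn
      rw [Set.mem_singleton_iff] at hjn
      subst hjn
      exact hcon.1 hj
    · intro j hj
      rw [mem_supported]
      intro k hk hkn
      rw [Set.mem_singleton_iff] at hkn
      subst hkn
      exact hcon.2 j hk hj
  exact mem_supported.1 h hi rfl

/-- The Lie algebra `W_fin(F)`: the vector fields `∑ f_i ∂/∂x_i`, `f_i ∈ F[X]`, such that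
each variable occurs in only finitely many of the polynomials `f_i`. -/
def Wfin (F : Type*) [Field F] : LieSubalgebra F (WX F) where
  carrier := {D | ∀ n : ℕ, {i : ℕ | n ∈ (D (X i)).vars}.Finite}
  zero_mem' := fun n => by simp
  add_mem' := by
    classical
    intro D E hD hE n
    refine ((hD n).union (hE n)).subset fun i hi => ?_
    have h := vars_add_subset (D (X i)) (E (X i)) hi
    simpa using h
  smul_mem' := by
    intro c D hD n
    refine (hD n).subset fun i hi => ?_
    have h : c • D (X i) ∈ supported F (↑(D (X i)).vars : Set ℕ) :=
      Subalgebra.smul_mem _ (mem_supported.2 subset_rfl) c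
    exact mem_supported.1 h hi
  lie_mem' := by
    classical
    intro D E hD hE n
    refine ((finite_mem_vars_apply hD hE n).union (finite_mem_vars_apply hE hD n)).subset
      fun i hi => ?_
    have hi' : n ∈ (D (E (X i)) - E (D (X i))).vars := by
      rw [← Derivation.commutator_apply]
      exact hi
    have h := vars_sub_subset (D (E (X i))) hi'
    simpa using h

end PolyVect

namespace PolyVect

open MvPolynomial

variable {F : Type*} [Field F]

/-! Write ∂_i for ∂/∂x_i. Since [∂_i, a](x_k) = ∂_i(a(x_k)), matching d with [·, a] on all ∂_i means
finding, for each k, a polynomial whose gradient is formed by the x_k-coefficients of the d(∂_i).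
Commutation of the ∂_i makes this one-form closed, and the Poincaré lemma `exists_pderiv_eq`
integrates it (`exists_lie_field_one_eq`).

The difference δ = d - [·, a], valued in W_X(F), kills every ∂_i. A constant field ∑ c_k ∂_k
commutes with all ∂_i and corrects δ on the x_i ∂_i (`IsLeibniz.exists_constant`). What remains
vanishes by induction on degree, comparing weights under the x_i ∂_i (`IsLeibniz.eq_zero`).

The Euler field gives the derivation that is not inner. -/

theorem WX.lie_zero (a : WX F) : ⁅a, (0 : WX F)⁆ = 0 := _root_.lie_zero a

theorem WX.lie_add (a b c : WX F) : ⁅a, b + c⁆ = ⁅a, b⁆ + ⁅a, c⁆ := _root_.lie_add a b c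

theorem WX.lie_sub (a b c : WX F) : ⁅a, b - c⁆ = ⁅a, b⁆ - ⁅a, c⁆ := _root_.lie_sub a b c

theorem WX.add_lie (a b c : WX F) : ⁅a + b, c⁆ = ⁅a, c⁆ + ⁅b, c⁆ := _root_.add_lie a b c

theorem WX.smul_lie (r : F) (a b : WX F) : ⁅r • a, b⁆ = r • ⁅a, b⁆ := _root_.smul_lie r a b

theorem WX.lie_lie (a b c : WX F) : ⁅⁅a, b⁆, c⁆ = ⁅a, ⁅b, c⁆⁆ - ⁅b, ⁅a, c⁆⁆ :=
  _root_.lie_lie a b c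

theorem Winf.coe_zero : ((0 : Winf F) : WX F) = 0 := rfl

theorem Winf.coe_add (x y : Winf F) : ((x + y : Winf F) : WX F) = x + y := rfl

theorem Winf.coe_smul (c : F) (x : Winf F) : ((c • x : Winf F) : WX F) = c • (x : WX F) := rfl

theorem mem_Winf {D : WX F} : D ∈ Winf F ↔ ∃ n, D ∈ Wn F n :=
  Set.mem_iUnion

/-! ### Coordinate fields and their brackets -/

theorem smul_pderiv_mem_Winf (p : Poly F) (j : ℕ) : (p • pderiv j : WX F) ∈ Winf F := by
  obtain ⟨n, hn⟩ := p.vars.bddAbove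
  refine mem_Winf.2 ⟨max (n + 1) (j + 1), fun i _ => ?_, fun i hi => ?_⟩
  · have hp : p ∈ supported F (Set.Iio (max (n + 1) (j + 1))) := by
      rw [mem_supported]
      intro k hk
      have := hn hk
      simp only [Set.mem_Iio]
      omega
    rw [Derivation.smul_apply, smul_eq_mul, pderiv_X]
    refine mul_mem hp ?_
    by_cases h : j = i
    · subst h; simp
    · rw [Pi.single_eq_of_ne (Ne.symm h)]; exact zero_mem _
  · have h : i ≠ j := by omega
    rw [Derivation.smul_apply, pderiv_X, Pi.single_eq_of_ne h, smul_zero]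

/-- The vector field `p ∂/∂x_j`, as an element of `W_∞(F)` depending linearly on `p`. -/
noncomputable def field (j : ℕ) : Poly F →ₗ[F] Winf F where
  toFun p := ⟨p • pderiv j, smul_pderiv_mem_Winf p j⟩
  map_add' p q := Subtype.ext (add_smul p q _)
  map_smul' c p := Subtype.ext (smul_assoc c p _)

@[simp]
theorem coe_field (j : ℕ) (p : Poly F) : (field j p : WX F) = p • pderiv j := rfl

@[simp]
theorem field_apply_X (j k : ℕ) (p : Poly F) :
    (field j p : WX F) (X k) = if k = j then p else 0 := by
  rw [coe_field, Derivation.smul_apply, pderiv_X, smul_eq_mul, Pi.single_apply]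
  split_ifs <;> simp

theorem lie_pderiv_apply_X (i k : ℕ) (a : WX F) :
    ⁅(pderiv i : WX F), a⁆ (X k) = pderiv i (a (X k)) := by
  rw [Derivation.commutator_apply, pderiv_X, Pi.single_apply]
  split_ifs <;> simp

theorem lie_field_one_apply_X (i k : ℕ) (a : WX F) :
    ⁅(field i (1 : Poly F) : WX F), a⁆ (X k) = pderiv i (a (X k)) := by
  rw [coe_field, one_smul, lie_pderiv_apply_X]

theorem lie_field_X_apply_X (i k : ℕ) (a : WX F) :
    ⁅(field i (X i : Poly F) : WX F), a⁆ (X k) =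
      X i * pderiv i (a (X k)) - if k = i then a (X k) else 0 := by
  rw [Derivation.commutator_apply, field_apply_X, coe_field, Derivation.smul_apply, smul_eq_mul]
  split_ifs with h
  · rw [h]
  · simp

theorem lie_field_one_field (i j : ℕ) (p : Poly F) :
    ⁅field i (1 : Poly F), field j p⁆ = field j (pderiv i p) := by
  refine Subtype.ext (derivation_ext fun k => ?_)
  rw [LieSubalgebra.coe_bracket, lie_field_one_apply_X, field_apply_X, field_apply_X]
  split_ifs <;> simp

theorem X_mul_pderiv_monomial_eq (i : ℕ) (s : ℕ →₀ ℕ) (c : F) :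
    X i * pderiv i (monomial s c) = (s i : F) • monomial s c := by
  rw [X_mul_pderiv_monomial, Nat.cast_smul_eq_nsmul]

theorem lie_field_X_field_monomial (i j : ℕ) (s : ℕ →₀ ℕ) (c : F) :
    ⁅field i (X i : Poly F), field j (monomial s c)⁆ =
      ((s i : F) - if i = j then 1 else 0) • field j (monomial s c) := by
  refine Subtype.ext (derivation_ext fun k => ?_)
  rw [LieSubalgebra.coe_bracket, lie_field_X_apply_X, Winf.coe_smul,
    Derivation.smul_apply, field_apply_X, sub_smul]
  by_cases hkj : k = j
  · subst hkj
    rw [if_pos rfl, X_mul_pderiv_monomial_eq]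
    congr 1
    by_cases h : k = i
    · subst h; simp
    · simp [h, Ne.symm h]
  · simp [hkj]

theorem eq_sum_field {n : ℕ} {x : Winf F} (hx : (x : WX F) ∈ Wn F n) :
    x = ∑ j ∈ Finset.range n, field j ((x : WX F) (X j)) := by
  refine Subtype.ext (derivation_ext fun k => ?_)
  have h : ((∑ j ∈ Finset.range n, field j ((x : WX F) (X j)) : Winf F) : WX F) (X k) =
      ∑ j ∈ Finset.range n, (field j ((x : WX F) (X j)) : WX F) (X k) := by
    rw [AddSubmonoidClass.coe_finsetSum, ← Derivation.coeFnAddMonoidHom_apply, map_sum,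
      Finset.sum_apply]
    rfl
  rw [h]
  simp only [field_apply_X, Finset.sum_ite_eq, Finset.mem_range]
  split_ifs with hk
  · rfl
  · exact hx.2 k (not_lt.1 hk)

theorem linearMap_eq_zero_of_field {M : Type*} [AddCommGroup M] [Module F M]
    (δ : Winf F →ₗ[F] M) (h : ∀ j s, δ (field j (monomial s 1)) = 0) : δ = 0 := by
  have h' : ∀ j, δ ∘ₗ field j = 0 := fun j => by
    refine linearMap_ext fun s => LinearMap.ext_ring ?_
    simpa using h j s
  refine LinearMap.ext fun x => ?_
  obtain ⟨n, hn⟩ := mem_Winf.1 x.2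
  rw [eq_sum_field hn, map_sum]
  exact Finset.sum_eq_zero fun j _ => LinearMap.congr_fun (h' j) _

/-! ### The polynomial Poincaré lemma -/

/-- Integration of polynomials with respect to `x_j`, without constant term. -/
noncomputable def integrate (j : ℕ) : Poly F →ₗ[F] Poly F :=
  (basisMonomials ℕ F).constr F fun s => monomial (s + Finsupp.single j 1) ((s j + 1 : F)⁻¹)

theorem integrate_monomial (j : ℕ) (s : ℕ →₀ ℕ) :
    integrate j (monomial s (1 : F)) = monomial (s + Finsupp.single j 1) ((s j + 1 : F)⁻¹) := by
  have h := (basisMonomials ℕ F).constr_basis F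
    (fun s => monomial (s + Finsupp.single j 1) ((s j + 1 : F)⁻¹)) s
  rwa [coe_basisMonomials] at h

section CharZero

variable [CharZero F]

theorem pderiv_integrate_self (j : ℕ) (p : Poly F) : pderiv j (integrate j p) = p := by
  suffices h : (pderiv j : WX F).toLinearMap ∘ₗ integrate j = LinearMap.id from
    LinearMap.congr_fun h p
  refine linearMap_ext fun s => LinearMap.ext_ring ?_
  have hs : (s j + 1 : F) ≠ 0 := Nat.cast_add_one_ne_zero _
  simp [integrate_monomial, pderiv_monomial, hs]

omit [CharZero F] in
theorem pderiv_integrate_of_ne {i j : ℕ} (hij : i ≠ j) (p : Poly F) :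
    pderiv i (integrate j p) = integrate j (pderiv i p) := by
  suffices h : (pderiv i : WX F).toLinearMap ∘ₗ integrate j =
      integrate j ∘ₗ (pderiv i : WX F).toLinearMap from LinearMap.congr_fun h p
  refine linearMap_ext fun s => LinearMap.ext_ring ?_
  have h1 : (monomial (s - Finsupp.single i 1) (s i : F)) =
      (s i : F) • monomial (s - Finsupp.single i 1) 1 := by
    rw [smul_monomial, smul_eq_mul, mul_one]
  have h3 : integrate j (monomial (s - Finsupp.single i 1) (s i : F)) =
      monomial (s - Finsupp.single i 1 + Finsupp.single j 1) ((s i : F) * (s j + 1 : F)⁻¹) := by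
    rw [h1, map_smul, integrate_monomial, smul_monomial, smul_eq_mul]
    simp [Finsupp.single_eq_of_ne (Ne.symm hij)]
  simp only [LinearMap.comp_apply, Derivation.coeFn_coe, integrate_monomial, pderiv_monomial,
    one_mul, h3]
  rcases Nat.eq_zero_or_pos (s i) with h0 | h0
  · simp [h0, hij]
  · have h2 : s + Finsupp.single j 1 - Finsupp.single i 1 =
        s - Finsupp.single i 1 + Finsupp.single j 1 := by
      ext k
      simp only [Finsupp.tsub_apply, Finsupp.add_apply, Finsupp.single_apply]
      split_ifs <;> omega
    rw [h2]
    simp [hij, mul_comm]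

/-- The Poincaré lemma for closed polynomial one-forms `∑ g_i dx_i`. -/
theorem exists_pderiv_eq (S : Finset ℕ) (g : ℕ → Poly F) (hS : ∀ i ∉ S, g i = 0)
    (hg : ∀ i j, pderiv i (g j) = pderiv j (g i)) : ∃ p : Poly F, ∀ i, pderiv i p = g i := by
  induction S using Finset.induction_on generalizing g with
  | empty => exact ⟨0, fun i => by rw [map_zero, hS i (Finset.notMem_empty i)]⟩
  | insert j S _ ih =>
    have hcomm : ∀ i k (q : Poly F), pderiv i (pderiv k q) = pderiv k (pderiv i q) := by
      intro i k q
      have h : ⁅(pderiv i : WX F), pderiv k⁆ = 0 := derivation_ext fun l => by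
        rw [lie_pderiv_apply_X, pderiv_X, Pi.single_apply]
        split_ifs <;> simp
      have hq := DFunLike.congr_fun h q
      rwa [Derivation.commutator_apply, Derivation.zero_apply, sub_eq_zero] at hq
    -- Subtracting the gradient of ∫ g_j dx_j kills the j-th component. Outside S ∪ {j} nothing new
    -- appears, as ∂_i g_j = ∂_j g_i = 0 there.
    have hsupp : ∀ i ∉ S, g i - pderiv i (integrate j (g j)) = 0 := fun i hi => by
      by_cases hij : i = j
      · rw [hij, pderiv_integrate_self, sub_self]
      · rw [pderiv_integrate_of_ne hij, hg, hS i (by simp [hij, hi]), map_zero, map_zero, sub_zero]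
    obtain ⟨p, hp⟩ := ih (fun i => g i - pderiv i (integrate j (g j))) hsupp
      fun i k => by rw [map_sub, map_sub, hg, hcomm]
    exact ⟨p + integrate j (g j), fun i => by rw [map_add, hp, sub_add_cancel]⟩

theorem pderiv_ne_zero_of_mem_vars {p : Poly F} {i : ℕ} (h : i ∈ p.vars) : pderiv i p ≠ 0 := by
  obtain ⟨s, hs, his⟩ := (mem_vars_iff_mem_support i).1 h
  intro h0
  have h1 := coeff_pderiv p (s - Finsupp.single i 1) (i := i)
  have h2 : Finsupp.single i 1 ≤ s := by
    rw [Finsupp.single_le_iff]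
    exact Nat.one_le_iff_ne_zero.2 (Finsupp.mem_support_iff.1 his)
  rw [h0, coeff_zero, tsub_add_cancel_of_le h2] at h1
  exact mul_ne_zero (mem_support_iff.1 hs) (Nat.cast_add_one_ne_zero _) h1.symm

theorem eq_C_of_pderiv_eq_zero {p : Poly F} (h : ∀ i, pderiv i p = 0) : ∃ c, p = C c := by
  refine ⟨_, (vars_eq_empty_iff_eq_C.1 ?_)⟩
  exact Finset.eq_empty_of_forall_notMem fun i hi => pderiv_ne_zero_of_mem_vars hi (h i)

/-! ### Derivations vanishing on the ∂_i -/

omit [CharZero F] in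
theorem lie_field_one_eq_zero {n i : ℕ} (hi : n ≤ i) {x : WX F} (hx : x ∈ Wn F n) :
    ⁅(field i (1 : Poly F) : WX F), x⁆ = 0 := by
  refine derivation_ext fun k => ?_
  rw [lie_field_one_apply_X, Derivation.zero_apply]
  rcases lt_or_ge k n with hk | hk
  · refine pderiv_eq_zero_of_notMem_vars fun h => ?_
    exact absurd (mem_supported.1 (hx.1 k hk) h) (not_lt.2 hi)
  · rw [hx.2 k hk, map_zero]

omit [CharZero F] in
theorem field_pderiv_X_eq (l i : ℕ) :
    field i (pderiv l (X i : Poly F)) = if l = i then field i 1 else 0 := by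
  rw [pderiv_X, Pi.single_apply]
  by_cases h : l = i
  · simp [h]
  · simp [h, Ne.symm h]

/-- A `W_X(F)`-valued derivation of `W_∞(F)`, as a linear map. -/
def IsLeibniz (δ : Winf F →ₗ[F] WX F) : Prop :=
  ∀ x y : Winf F, δ ⁅x, y⁆ = ⁅(x : WX F), δ y⁆ - ⁅(y : WX F), δ x⁆

/-- Once δ kills ∂_i it commutes with bracketing by ∂_i, so differentiating a coefficient of δ(p
∂_j) gives one of δ((∂_i p) ∂_j) = 0. -/
theorem IsLeibniz.exists_eq_C {δ : Winf F →ₗ[F] WX F} (hδ : IsLeibniz δ)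
    (h1 : ∀ i, δ (field i 1) = 0) {j : ℕ} {p : Poly F}
    (hp : ∀ i, δ (field j (pderiv i p)) = 0) :
    ∃ c : ℕ → F, ∀ k, δ (field j p) (X k) = C (c k) := by
  refine Classical.skolem.1 fun k => eq_C_of_pderiv_eq_zero fun i => ?_
  have h := hδ (field i 1) (field j p)
  rw [lie_field_one_field, hp, h1, WX.lie_zero, sub_zero] at h
  rw [← lie_field_one_apply_X, ← h, Derivation.zero_apply]

theorem IsLeibniz.eq_zero {δ : Winf F →ₗ[F] WX F} (hδ : IsLeibniz δ)
    (h1 : ∀ i, δ (field i 1) = 0) (hX : ∀ i, δ (field i (X i)) = 0) : δ = 0 := by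
  refine linearMap_eq_zero_of_field δ fun j s => ?_
  induction hs : s.degree using Nat.strong_induction_on generalizing s with
  | _ n ih =>
    subst hs
    obtain ⟨c, hc⟩ := hδ.exists_eq_C h1 (j := j) (p := monomial s 1) fun i => by
      rw [pderiv_monomial, one_mul]
      rcases Nat.eq_zero_or_pos (s i) with h0 | h0
      · simp [h0]
      · have h2 : Finsupp.single i 1 ≤ s := by
          rw [Finsupp.single_le_iff]
          exact h0
        have h3 : (s - Finsupp.single i 1).degree < s.degree := by
          have h4 := congrArg Finsupp.degree (tsub_add_cancel_of_le h2)
          rw [map_add, Finsupp.degree_single] at h4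
          omega
        have h5 : (monomial (s - Finsupp.single i 1) (s i : F)) =
            (s i : F) • monomial (s - Finsupp.single i 1) 1 := by
          rw [smul_monomial, smul_eq_mul, mul_one]
        rw [h5, map_smul, map_smul, ih _ h3 _ rfl, smul_zero]
    -- Under x_i ∂_i the field x^s ∂_j has weight s_i - δ_ij, while the constant field ∂_k has
    -- weight -δ_ik.
    have key : ∀ i k, ((s i : F) - if i = j then 1 else 0) * c k = - if k = i then c k else 0 := by
      intro i k
      have h := hδ (field i (X i)) (field j (monomial s 1))
      rw [lie_field_X_field_monomial, hX, WX.lie_zero, sub_zero, map_smul] at h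
      have h' := DFunLike.congr_fun h (X k)
      rw [lie_field_X_apply_X, Derivation.smul_apply, hc, pderiv_C, mul_zero, zero_sub,
        smul_eq_C_mul, ← C_mul] at h'
      refine C_injective ℕ F ?_
      rw [h', map_neg]
      split_ifs <;> simp
    by_cases hi : ∃ i, (if i = j then 1 else 0) < s i
    -- The weight of x^s ∂_j is now a positive integer, that of ∂_k is never positive; in
    -- characteristic zero they differ.
    · obtain ⟨i, hi⟩ := hi
      refine derivation_ext fun k => ?_
      rw [hc, Derivation.zero_apply]
      obtain ⟨m, hm⟩ := Nat.exists_eq_add_of_lt hi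
      have hk := key i k
      have hm' : ((s i : F) - if i = j then 1 else 0) = m + 1 := by
        rw [hm]
        split_ifs <;> push_cast <;> ring
      rw [hm'] at hk
      have : c k = 0 := by
        split_ifs at hk
        · have h2 : ((m : F) + 1 + 1) * c k = 0 := by linear_combination hk
          exact (mul_eq_zero.1 h2).resolve_left (by exact_mod_cast Nat.succ_ne_zero (m + 1))
        · rw [neg_zero] at hk
          exact (mul_eq_zero.1 hk).resolve_left (Nat.cast_add_one_ne_zero m)
      rw [this, C_0]
    -- Only ∂_j and x_j ∂_j are left, covered by the hypotheses.
    · push Not at hi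
      have hs : s = Finsupp.single j (s j) := by
        ext i
        rw [Finsupp.single_apply]
        split_ifs with h
        · rw [h]
        · simpa [Ne.symm h] using hi i
      have hj := hi j
      rw [if_pos rfl] at hj
      rw [hs]
      rcases Nat.le_one_iff_eq_zero_or_eq_one.1 hj with h0 | h0
      · rw [h0, Finsupp.single_zero]
        exact h1 j
      · rw [h0]
        exact hX j

theorem IsLeibniz.exists_constant {δ : Winf F →ₗ[F] WX F} (hδ : IsLeibniz δ)
    (h1 : ∀ i, δ (field i 1) = 0) :
    ∃ c : ℕ → F, ∀ i, δ (field i (X i)) =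
      ⁅(field i (X i : Poly F) : WX F), mkDerivation F fun k => (C (c k) : Poly F)⁆ := by
  have hex : ∀ i, ∃ c : ℕ → F, ∀ k, δ (field i (X i)) (X k) = C (c k) := fun i =>
    hδ.exists_eq_C h1 fun l => by
      rw [field_pderiv_X_eq]
      split_ifs
      · exact h1 i
      · exact map_zero δ
  choose c hc using hex
  refine ⟨fun k => -c k k, fun i => derivation_ext fun k => ?_⟩
  rw [lie_field_X_apply_X, mkDerivation_X, pderiv_C, mul_zero, zero_sub, hc]
  split_ifs with h
  · rw [h, map_neg, neg_neg]
  -- Applying δ to [x_i ∂_i, x_k ∂_k] = 0 kills the off-diagonal constants.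
  · have h2 := hδ (field i (X i)) (field k (X k))
    have h3 : ⁅field i (X i : Poly F), field k (X k : Poly F)⁆ = 0 := by
      have := lie_field_X_field_monomial i k (Finsupp.single k 1) (1 : F)
      rw [show (X k : Poly F) = monomial (Finsupp.single k 1) 1 from rfl, this]
      by_cases hik : i = k
      · exact absurd hik.symm h
      · simp [hik]
    rw [h3, map_zero] at h2
    have h4 := DFunLike.congr_fun h2 (X k)
    rw [Derivation.sub_apply, lie_field_X_apply_X, lie_field_X_apply_X, hc, hc, pderiv_C, pderiv_C,
      if_neg h, if_pos rfl] at h4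
    simpa using h4.symm

/-! ### Every derivation comes from `Wfin` -/

/-- The linear map `x ↦ d x - [x, a]`. -/
noncomputable def subAd (d : LieDerivation F (Winf F) (Winf F)) (a : WX F) : Winf F →ₗ[F] WX F where
  toFun x := (d x : WX F) - ⁅(x : WX F), a⁆
  map_add' x y := by
    rw [map_add, Winf.coe_add, Winf.coe_add, WX.add_lie]
    abel
  map_smul' c x := by
    rw [map_smul, Winf.coe_smul, Winf.coe_smul, WX.smul_lie]
    exact (smul_sub c (d x : WX F) ⁅(x : WX F), a⁆).symm

omit [CharZero F] in
theorem subAd_apply (d : LieDerivation F (Winf F) (Winf F)) (a : WX F) (x : Winf F) :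
    subAd d a x = (d x : WX F) - ⁅(x : WX F), a⁆ := rfl

omit [CharZero F] in
theorem coe_apply_lie (d : LieDerivation F (Winf F) (Winf F)) (x y : Winf F) :
    (d ⁅x, y⁆ : WX F) = ⁅(x : WX F), (d y : WX F)⁆ - ⁅(y : WX F), (d x : WX F)⁆ := by
  rw [LieDerivation.apply_lie_eq_sub]
  rfl

omit [CharZero F] in
theorem isLeibniz_subAd (d : LieDerivation F (Winf F) (Winf F)) (a : WX F) :
    IsLeibniz (subAd d a) := fun x y => by
  rw [subAd_apply, subAd_apply, subAd_apply, coe_apply_lie, LieSubalgebra.coe_bracket, WX.lie_lie,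
    WX.lie_sub, WX.lie_sub]
  abel

theorem exists_lie_field_one_eq (d : LieDerivation F (Winf F) (Winf F)) :
    ∃ a ∈ Wfin F, ∀ i, (d (field i 1) : WX F) = ⁅(field i (1 : Poly F) : WX F), a⁆ := by
  have hlie : ∀ i j, ⁅field i (1 : Poly F), field j (1 : Poly F)⁆ = 0 := fun i j => by
    rw [lie_field_one_field, pderiv_one, map_zero]
  have hclosed : ∀ k i j, pderiv i ((d (field j 1) : WX F) (X k)) =
      pderiv j ((d (field i 1) : WX F) (X k)) := fun k i j => by
    have h := coe_apply_lie d (field i 1) (field j 1)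
    rw [hlie, map_zero, Winf.coe_zero] at h
    rw [← lie_field_one_apply_X, ← lie_field_one_apply_X, sub_eq_zero.1 h.symm]
  -- For large i, ∂_i commutes with both y and d(y), so applying d to [∂_i, y] = 0 leaves [y,
  -- d(∂_i)] = 0.
  have hvanish : ∀ y : Winf F, ∃ n, ∀ i ≥ n, ⁅(y : WX F), (d (field i 1) : WX F)⁆ = 0 := by
    intro y
    obtain ⟨m, hm⟩ := mem_Winf.1 y.2
    obtain ⟨n, hn⟩ := mem_Winf.1 (d y).2
    refine ⟨max m n, fun i hi => ?_⟩
    have h := coe_apply_lie d (field i 1) y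
    have h0 : ⁅field i (1 : Poly F), y⁆ = 0 :=
      Subtype.ext (lie_field_one_eq_zero ((le_max_left m n).trans hi) hm)
    rw [h0, map_zero, Winf.coe_zero,
      lie_field_one_eq_zero ((le_max_right m n).trans hi) hn, zero_sub] at h
    exact neg_eq_zero.1 h.symm
  have hex : ∀ k, ∃ p : Poly F, ∀ i, pderiv i p = (d (field i 1) : WX F) (X k) := by
    intro k
    -- If f is the x_k-coefficient of d(∂_i), then y = ∂_k gives ∂_k f = 0 and y = x_k ∂_k gives x_k
    -- ∂_k f - f = 0, so f = 0 for large i.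
    obtain ⟨m, hm⟩ := hvanish (field k 1)
    obtain ⟨n, hn⟩ := hvanish (field k (X k))
    refine exists_pderiv_eq (Finset.range (max m n)) _ (fun i hi => ?_) (hclosed k)
    rw [Finset.mem_range, not_lt, max_le_iff] at hi
    have h1 := DFunLike.congr_fun (hm i hi.1) (X k)
    have h2 := DFunLike.congr_fun (hn i hi.2) (X k)
    rw [lie_field_one_apply_X, Derivation.zero_apply] at h1
    rw [lie_field_X_apply_X, h1, if_pos rfl, mul_zero, zero_sub] at h2
    exact neg_eq_zero.1 h2
  choose p hp using hex
  refine ⟨mkDerivation F p, fun n => ?_, fun i => derivation_ext fun k => ?_⟩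
  -- Only finitely many coefficients ∂_n p_k of d(∂_n) are nonzero, so x_n occurs in finitely many
  -- p_k.
  · obtain ⟨m, hm⟩ := mem_Winf.1 (d (field n 1)).2
    refine (Set.finite_Iio m).subset fun k hk => ?_
    by_contra hkm
    rw [Set.mem_ofPred_eq, mkDerivation_X] at hk
    refine pderiv_ne_zero_of_mem_vars hk ?_
    rw [hp, hm.2 k (not_lt.1 hkm)]
  · rw [lie_field_one_apply_X, mkDerivation_X, hp]

theorem exists_mem_Wfin_eq_lie (d : LieDerivation F (Winf F) (Winf F)) :
    ∃ a ∈ Wfin F, ∀ x : Winf F, (d x : WX F) = ⁅(x : WX F), a⁆ := by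
  obtain ⟨a, ha, had⟩ := exists_lie_field_one_eq d
  obtain ⟨c, hc⟩ := (isLeibniz_subAd d a).exists_constant fun i => by
    rw [subAd_apply, had, sub_self]
  have hb : (mkDerivation F fun k => (C (c k) : Poly F)) ∈ Wfin F := fun n => by
    simp [mkDerivation_X]
  refine ⟨_, add_mem ha hb, fun x => ?_⟩
  have h0 := (isLeibniz_subAd d _).eq_zero (δ := subAd d (a + mkDerivation F fun k => C (c k)))
    (fun i => ?_) fun i => ?_
  · exact sub_eq_zero.1 (DFunLike.congr_fun h0 x)
  · have h1 : ⁅(field i (1 : Poly F) : WX F), mkDerivation F fun k => (C (c k) : Poly F)⁆ = 0 :=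
      derivation_ext fun k => by
        rw [lie_field_one_apply_X, mkDerivation_X, pderiv_C, Derivation.zero_apply]
    rw [subAd_apply, WX.lie_add, h1, add_zero, had, sub_self]
  · rw [subAd_apply, WX.lie_add, ← hc, subAd_apply]
    abel

end CharZero

/-! ### A derivation that is not inner -/

/-- The Euler vector field `∑ x_i ∂/∂x_i`. -/
noncomputable def euler (F : Type*) [Field F] : WX F := mkDerivation F X

theorem lie_euler_mem_Winf {x : WX F} (hx : x ∈ Winf F) : ⁅x, euler F⁆ ∈ Winf F := by
  obtain ⟨n, hn⟩ := mem_Winf.1 hx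
  refine mem_Winf.2 ⟨n, fun i hi => ?_, fun i hi => ?_⟩ <;>
    rw [Derivation.commutator_apply, euler, mkDerivation_X]
  · refine sub_mem (hn.1 i hi) (apply_mem_supported _ subset_rfl (fun k hk => ?_) (hn.1 i hi))
    rw [mkDerivation_X]
    exact X_mem_supported.2 hk
  · rw [hn.2 i hi, map_zero, sub_zero]

/-- The derivation `x ↦ [x, ∑ x_i ∂/∂x_i]` of `W_∞(F)`. -/
noncomputable def eulerLieDerivation (F : Type*) [Field F] :
    LieDerivation F (Winf F) (Winf F) where
  toFun x := ⟨⁅(x : WX F), euler F⁆, lie_euler_mem_Winf x.2⟩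
  map_add' x y := Subtype.ext (WX.add_lie (x : WX F) (y : WX F) (euler F))
  map_smul' c x := Subtype.ext (WX.smul_lie c (x : WX F) (euler F))
  leibniz' x y := Subtype.ext (WX.lie_lie (x : WX F) (y : WX F) (euler F))

theorem eulerLieDerivation_not_inner :
    ¬ ∃ b : Winf F, ∀ x : Winf F, eulerLieDerivation F x = ⁅x, b⁆ := by
  rintro ⟨b, hb⟩
  obtain ⟨n, hn⟩ := mem_Winf.1 b.2
  have h : ⁅(field n (1 : Poly F) : WX F), euler F⁆ = ⁅(field n (1 : Poly F) : WX F), (b : WX F)⁆ :=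
    congrArg Subtype.val (hb (field n 1))
  -- An element b of W_n commutes with the derivative in the first variable outside W_n, but the
  -- Euler field does not.
  rw [lie_field_one_eq_zero le_rfl hn] at h
  have h' := DFunLike.congr_fun h (X n)
  rw [lie_field_one_apply_X, euler, mkDerivation_X, pderiv_X_self, Derivation.zero_apply] at h'
  exact one_ne_zero h'

end PolyVect

theorem theorem1 (F : Type*) [Field F] [CharZero F] :
    (∀ D : LieDerivation F (PolyVect.Winf F) (PolyVect.Winf F),
      ∃ a ∈ PolyVect.Wfin F, ∀ x : PolyVect.Winf F,
        ((D x : PolyVect.Winf F) : PolyVect.WX F) = ⁅(x : PolyVect.WX F), a⁆) ∧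
    ¬ ∀ D : LieDerivation F (PolyVect.Winf F) (PolyVect.Winf F),
      ∃ b : PolyVect.Winf F, ∀ x : PolyVect.Winf F, D x = ⁅x, b⁆ :=
  ⟨PolyVect.exists_mem_Wfin_eq_lie, fun h =>
    PolyVect.eulerLieDerivation_not_inner (h (PolyVect.eulerLieDerivation F))⟩
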